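/- Let $n\ge 0$, let $U\subset\mathbb C$ be a domain (a non-empty connected open set) and let $f:U\to\mathbb P^n=\mathbb P^n(\mathbb C)$ be a holomorphic curve. Let $\nabla$ be the connection in the holomorphic tangent bundle $T\mathbb P^n$ induced by the Fubini–Study metric: in each affine coordinate system $w=(w^1,\dots,w^n)$ of $\mathbb P^n$, $w^k=z_{j_k}/z_i$ on $\{z_i\ne 0\}$ where $j_1<\dots<j_n$ are the indices other than $i$, the metric is $g_{j\bar l}=\partial^2\log(1+\|w\|^2)/\partial w^j\partial\bar w^l$, and $\nabla_{\partial_i}\partial_j=\sum_k\Gamma^k_{ij}\partial_k$ with $\Gamma^k_{ij}=\sum_l \frac{\partial g_{j\bar l}}{\partial w^i}\,g^{\bar l k}$, where $(g^{\bar l k})$ is the inverse matrix of $(g_{j\bar l})$. Put $$f^{(1)}(z)=f'(z)\in T_{f(z)}\mathbb P^n,\qquad f^{(k)}(z)=\nabla_{f'(z)}f^{(k-1)}(z)\quad(k\ge 2),$$ where for a field $V=\sum_k V^k\partial_k$ of holomorphic tangent vectors along $f$ one has $(\nabla_{f'}V)^k=\frac{\partial V^k}{\partial z}+\sum_{a,b}\Gamma^k_{ab}(f)\,(f')^aV^b$,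 and define the Wronskian $$W(\nabla,f)(z)=f^{(1)}(z)\wedge\cdots\wedge f^{(n)}(z)\in \textstyle\bigwedge^n T_{f(z)}\mathbb P^n=K^*_{\mathbb P^n,f(z)},$$ $K_{\mathbb P^n}$ being the canonical bundle. Then: (i) $W(\nabla,f)\equiv 0$ on $U$ (that is, $f$ is $\nabla$-degenerate) if and only if $f(U)$ is contained in a hyperplane of $\mathbb P^n$, i.e. in the zero set of a nonzero linear form on $\mathbb C^{n+1}$. (ii) $W(\nabla,f)(z)$ is holomorphic in $z\in U$: in each affine coordinate system its coefficient with respect to $\partial_1\wedge\cdots\wedge\partial_n$ is a holomorphic function on the set of $z\in U$ where $f(z)$ lies in that coordinate system. -/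

import Mathlib

open scoped LinearAlgebra.Projectivization Manifold ContDiff

noncomputable section

namespace FubiniStudy

/-! ### The complex manifold `ℙⁿ` -/

/-- Complex projective space `ℙⁿ`: the lines in `ℂⁿ⁺¹`. -/
abbrev ProjSpace (n : ℕ) : Type := ℙ ℂ (Fin (n + 1) → ℂ)

/-- The quotient topology from `ℂⁿ⁺¹ ∖ {0}`. -/
instance instTopologicalSpaceProjSpace (n : ℕ) : TopologicalSpace (ProjSpace n) :=
  inferInstanceAs (TopologicalSpace
    (Quotient (projectivizationSetoid ℂ (Fin (n + 1) → ℂ))))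

variable {n : ℕ}

/-- The open set `{ zᵢ ≠ 0 }` of `ℙⁿ`. -/
def affineSet (i : Fin (n + 1)) : Set (ProjSpace n) := {p | p.rep i ≠ 0}

/-- The affine coordinates `(z₀/zᵢ, …, zₙ/zᵢ)` (the entry `zᵢ/zᵢ` left out). -/
def affineCoord (i : Fin (n + 1)) (p : ProjSpace n) : Fin n → ℂ :=
  fun k => p.rep (i.succAbove k) / p.rep i

/-- The vector `(w¹, …, 1, …, wⁿ)` with `1` at place `i`. -/
def affineLift (i : Fin (n + 1)) (w : Fin n → ℂ) : Fin (n + 1) → ℂ :=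
  i.insertNth (α := fun _ => ℂ) 1 w

theorem affineLift_self (i : Fin (n + 1)) (w : Fin n → ℂ) : affineLift i w i = 1 := by
  simp [affineLift]

theorem affineLift_succAbove (i : Fin (n + 1)) (w : Fin n → ℂ) (k : Fin n) :
    affineLift i w (i.succAbove k) = w k := by
  simp [affineLift]

theorem affineLift_ne_zero (i : Fin (n + 1)) (w : Fin n → ℂ) : affineLift i w ≠ 0 := by
  intro h
  have := affineLift_self i w
  rw [h] at this
  exact zero_ne_one this

/-- The point of `ℙⁿ` with affine coordinates `w` in `{ zᵢ ≠ 0 }`. -/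
def affinePoint (i : Fin (n + 1)) (w : Fin n → ℂ) : ProjSpace n :=
  Projectivization.mk ℂ (affineLift i w) (affineLift_ne_zero i w)

theorem mk_mem_affineSet (i : Fin (n + 1)) (v : Fin (n + 1) → ℂ) (hv : v ≠ 0) :
    Projectivization.mk ℂ v hv ∈ affineSet i ↔ v i ≠ 0 := by
  obtain ⟨a, ha⟩ := Projectivization.exists_smul_eq_mk_rep ℂ v hv
  simp only [affineSet, Set.mem_ofPred_eq]
  rw [← ha]
  simp [Units.smul_def]

theorem affineCoord_mk (i : Fin (n + 1)) (v : Fin (n + 1) → ℂ) (hv : v ≠ 0) :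
    affineCoord i (Projectivization.mk ℂ v hv) = fun k => v (i.succAbove k) / v i := by
  obtain ⟨a, ha⟩ := Projectivization.exists_smul_eq_mk_rep ℂ v hv
  funext k
  simp only [affineCoord]
  rw [← ha]
  simp only [Units.smul_def, Pi.smul_apply, smul_eq_mul]
  exact mul_div_mul_left _ _ a.ne_zero

theorem affineCoord_affinePoint (i : Fin (n + 1)) (w : Fin n → ℂ) :
    affineCoord i (affinePoint i w) = w := by
  rw [affinePoint, affineCoord_mk]
  funext k
  rw [affineLift_succAbove, affineLift_self, div_one]

theorem affinePoint_mem (i : Fin (n + 1)) (w : Fin n → ℂ) :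
    affinePoint i w ∈ affineSet i := by
  rw [affinePoint, mk_mem_affineSet, affineLift_self]
  exact one_ne_zero

theorem affinePoint_affineCoord (i : Fin (n + 1)) (p : ProjSpace n) (hp : p ∈ affineSet i) :
    affinePoint i (affineCoord i p) = p := by
  have hp' : p.rep i ≠ 0 := hp
  conv_rhs => rw [← p.mk_rep]
  rw [affinePoint, Projectivization.mk_eq_mk_iff']
  refine ⟨(p.rep i)⁻¹, ?_⟩
  funext l
  refine Fin.succAboveCases i ?_ ?_ l
  · rw [affineLift_self]
    simp [hp']
  · intro k
    rw [affineLift_succAbove]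
    simp only [Pi.smul_apply, smul_eq_mul, affineCoord]
    rw [div_eq_inv_mul]

theorem isQuotientMap_mk' :
    Topology.IsQuotientMap
      (Projectivization.mk' ℂ : {v : Fin (n + 1) → ℂ // v ≠ 0} → ProjSpace n) :=
  isQuotientMap_quot_mk

theorem isOpen_affineSet (i : Fin (n + 1)) : IsOpen (affineSet (n := n) i) := by
  rw [← isQuotientMap_mk'.isOpen_preimage]
  have h : (Projectivization.mk' ℂ ⁻¹' affineSet i : Set {v : Fin (n + 1) → ℂ // v ≠ 0})
      = {v | v.1 i ≠ 0} := by
    ext v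
    exact mk_mem_affineSet i v.1 v.2
  rw [h]
  exact isOpen_ne_fun ((continuous_apply i).comp continuous_subtype_val) continuous_const

theorem continuousOn_affineCoord (i : Fin (n + 1)) :
    ContinuousOn (affineCoord (n := n) i) (affineSet i) := by
  rw [isQuotientMap_mk'.continuousOn_isOpen_iff (isOpen_affineSet i)]
  have h : (affineCoord i ∘ Projectivization.mk' ℂ :
      {v : Fin (n + 1) → ℂ // v ≠ 0} → Fin n → ℂ)
      = fun v k => v.1 (i.succAbove k) / v.1 i := by
    funext v
    exact affineCoord_mk i v.1 v.2
  rw [h, continuousOn_pi]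
  intro k
  refine ContinuousOn.div ?_ ?_ ?_
  · exact ((continuous_apply _).comp continuous_subtype_val).continuousOn
  · exact ((continuous_apply _).comp continuous_subtype_val).continuousOn
  · intro v hv
    exact (mk_mem_affineSet i v.1 v.2).1 hv

theorem continuous_affineLift (i : Fin (n + 1)) : Continuous (affineLift (n := n) i) := by
  refine continuous_pi fun l => ?_
  refine Fin.succAboveCases i ?_ ?_ l
  · simp only [affineLift_self]
    exact continuous_const
  · intro k
    simp only [affineLift_succAbove]
    exact continuous_apply k

theorem continuous_affinePoint (i : Fin (n + 1)) : Continuous (affinePoint (n := n) i) :=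
  isQuotientMap_mk'.continuous.comp
    ((continuous_affineLift i).subtype_mk (affineLift_ne_zero i))

/-- The standard affine chart `{ zᵢ ≠ 0 } ≃ ℂⁿ`. -/
def affineChart (i : Fin (n + 1)) : OpenPartialHomeomorph (ProjSpace n) (Fin n → ℂ) where
  toFun := affineCoord i
  invFun := affinePoint i
  source := affineSet i
  target := Set.univ
  map_source' _ _ := Set.mem_univ _
  map_target' w _ := affinePoint_mem i w
  left_inv' p hp := affinePoint_affineCoord i p hp
  right_inv' w _ := affineCoord_affinePoint i w
  open_source := isOpen_affineSet i
  open_target := isOpen_univ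
  continuousOn_toFun := continuousOn_affineCoord i
  continuousOn_invFun := (continuous_affinePoint i).continuousOn

theorem exists_mem_affineSet (p : ProjSpace n) : ∃ i, p ∈ affineSet i := by
  by_contra! h
  refine p.rep_nonzero (funext fun i => ?_)
  have := h i
  simpa [affineSet] using this

/-- The index of some affine chart that contains `p`. -/
def chartIndex (p : ProjSpace n) : Fin (n + 1) := (exists_mem_affineSet p).choose

theorem mem_affineSet_chartIndex (p : ProjSpace n) : p ∈ affineSet (chartIndex p) :=
  (exists_mem_affineSet p).choose_spec

instance instChartedSpaceProjSpace (n : ℕ) : ChartedSpace (Fin n → ℂ) (ProjSpace n) where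
  atlas := Set.range affineChart
  chartAt p := affineChart (chartIndex p)
  mem_chart_source p := mem_affineSet_chartIndex p
  chart_mem_atlas p := ⟨chartIndex p, rfl⟩

theorem contDiff_affineLift (i : Fin (n + 1)) (l : Fin (n + 1)) :
    ContDiff ℂ ω fun w : Fin n → ℂ => affineLift i w l := by
  refine Fin.succAboveCases i ?_ ?_ l
  · simp only [affineLift_self]
    exact contDiff_const
  · intro k
    simp only [affineLift_succAbove]
    exact contDiff_apply ℂ ℂ k

/-- `ℙⁿ` is a complex (analytic) manifold. -/
instance instIsManifoldProjSpace (n : ℕ) :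
    IsManifold 𝓘(ℂ, Fin n → ℂ) ω (ProjSpace n) := by
  refine isManifold_of_contDiffOn _ _ _ ?_
  rintro _ _ ⟨i, rfl⟩ ⟨j, rfl⟩
  have h : (𝓘(ℂ, Fin n → ℂ) ∘ ((affineChart (n := n) i).symm.trans (affineChart j)) ∘
      𝓘(ℂ, Fin n → ℂ).symm) =
      fun w k => affineLift i w (j.succAbove k) / affineLift i w j := by
    funext w
    exact affineCoord_mk j _ (affineLift_ne_zero i w)
  rw [h, contDiffOn_pi]
  intro k
  refine ContDiffOn.div (contDiff_affineLift i _).contDiffOn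
    (contDiff_affineLift i _).contDiffOn ?_
  rintro w ⟨hw, -⟩
  have hw' : affinePoint i w ∈ affineSet j := hw.2
  exact (mk_mem_affineSet j _ (affineLift_ne_zero i w)).1 hw'

/-- The holomorphic tangent space of `ℙⁿ` at `p`. -/
abbrev Tan (p : ProjSpace n) : Type := TangentSpace 𝓘(ℂ, Fin n → ℂ) p

/-- The components `(X¹, …, Xⁿ)` of `X = ∑ Xᵏ ∂/∂wᵏ` in the affine chart `{ zᵢ ≠ 0 }`,
as a linear map (the differential of the chart). -/
def components (i : Fin (n + 1)) (p : ProjSpace n) : Tan p →L[ℂ] (Fin n → ℂ) :=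
  mfderiv 𝓘(ℂ, Fin n → ℂ) 𝓘(ℂ, Fin n → ℂ) (affineChart i) p

/-- A hyperplane of `ℙⁿ`: the zero set of a nonzero linear form on `ℂⁿ⁺¹`. -/
def IsHyperplane (H : Set (ProjSpace n)) : Prop :=
  ∃ l : (Fin (n + 1) → ℂ) →ₗ[ℂ] ℂ, l ≠ 0 ∧ H = {p | p.submodule ≤ LinearMap.ker l}

/-! ### The Fubini–Study metric and its connection -/

/-- The derivative of `h` along the `(1,0)`-vector `v`: on `ℂ` with `v = 1` this is
`∂/∂z = (∂/∂x - i ∂/∂y) / 2`, on `ℂⁿ` with `v = eⱼ` it is `∂/∂wʲ`. -/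
def dHol {E F : Type*} [NormedAddCommGroup E] [NormedSpace ℂ E]
    [NormedAddCommGroup F] [NormedSpace ℂ F] (h : E → F) (x v : E) : F :=
  (1 / 2 : ℂ) • (fderiv ℝ h x v - Complex.I • fderiv ℝ h x (Complex.I • v))

/-- The derivative of `h` along the `(0,1)`-vector conjugate to `v`: on `ℂⁿ` with `v = eⱼ` it is
`∂/∂w̄ʲ = (∂/∂x + i ∂/∂y) / 2`. -/
def dAnti {E F : Type*} [NormedAddCommGroup E] [NormedSpace ℂ E]
    [NormedAddCommGroup F] [NormedSpace ℂ F] (h : E → F) (x v : E) : F :=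
  (1 / 2 : ℂ) • (fderiv ℝ h x v + Complex.I • fderiv ℝ h x (Complex.I • v))

/-- The potential `log (1 + ‖w‖²)` of the Fubini–Study form in affine coordinates; here
`‖w‖` is the Hermitian norm, not Lean's norm of `Fin n → ℂ`. -/
def potential (w : Fin n → ℂ) : ℂ := (Real.log (1 + ∑ k, Complex.normSq (w k)) : ℝ)

/-- The Fubini–Study metric `g_{j l̄} = ∂ⱼ ∂̄ₗ log (1 + ‖w‖²)` in affine coordinates. The formula
is the same in all the affine charts, as the potentials differ by pluriharmonic functions. -/
def metric (w : Fin n → ℂ) : Matrix (Fin n) (Fin n) ℂ :=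
  Matrix.of fun j l => dHol (fun u => dAnti potential u (Pi.single l 1)) w (Pi.single j 1)

/-- The Christoffel symbols `Γᵏᵢⱼ = ∑ₗ (∂ᵢ g_{j l̄}) g^{l̄ k}` of the metric in affine
coordinates. -/
def christoffel (w : Fin n → ℂ) (k i j : Fin n) : ℂ :=
  ∑ l, dHol (fun u => metric u j l) w (Pi.single i 1) * (metric w)⁻¹ l k

/-- The derivative `f'(z) ∈ T_{f(z)} ℙⁿ` of a holomorphic curve. -/
def velocity (f : ℂ → ProjSpace n) (z : ℂ) : Tan (f z) :=
  mfderiv 𝓘(ℂ, ℂ) 𝓘(ℂ, Fin n → ℂ) f z (1 : ℂ)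

/-- The components, in the affine chart `{ zᵢ ≠ 0 }`, of the covariant derivative `∇_{f'} V` at
`z` of a field `V` of holomorphic tangent vectors along `f`:
`(∇_{f'} V)ᵏ = ∂(Vᵏ)/∂z + ∑ Γᵏₐᵦ(f) (f')ᵃ Vᵇ`. -/
def covDerivComponents (i : Fin (n + 1)) (f : ℂ → ProjSpace n)
    (V : (z : ℂ) → Tan (f z)) (z : ℂ) : Fin n → ℂ :=
  fun k => dHol (fun ζ => components i (f ζ) (V ζ) k) z 1 +
    ∑ a, ∑ b, christoffel (affineChart i (f z)) k a b *
      components i (f z) (velocity f z) a * components i (f z) (V z) b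

/-- The covariant derivative `∇_{f'} V` for the Fubini–Study connection `∇`: at `z` it is the
tangent vector at `f(z)` with the above components in an affine chart around `f(z)`. It does not
depend on the chart, as the metrics of the affine charts agree under the changes of charts. -/
def covDeriv (f : ℂ → ProjSpace n) (V : (z : ℂ) → Tan (f z)) (z : ℂ) : Tan (f z) :=
  (components (chartIndex (f z)) (f z)).inverse
    (covDerivComponents (chartIndex (f z)) f V z)

/-- `jet f k` is `f⁽ᵏ⁺¹⁾`: one has `f⁽¹⁾ = f'` and `f⁽ᵏ⁺¹⁾ = ∇_{f'} f⁽ᵏ⁾`. -/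
def jet (f : ℂ → ProjSpace n) : ℕ → (z : ℂ) → Tan (f z)
  | 0 => velocity f
  | k + 1 => covDeriv f (jet f k)

/-- The Wronskian `W(∇, f)(z) = f⁽¹⁾(z) ∧ ⋯ ∧ f⁽ⁿ⁾(z)`, in the top exterior power of the
holomorphic tangent space at `f(z)`, which is the fibre of the dual of the canonical bundle. -/
def wronskian (f : ℂ → ProjSpace n) (z : ℂ) : ⋀[ℂ]^n (Tan (f z)) :=
  exteriorPower.ιMulti ℂ n fun k : Fin n => jet f k z

/-- `f` is `∇`-degenerate on `U`: the Wronskian vanishes identically. -/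
def IsDegenerate (f : ℂ → ProjSpace n) (U : Set ℂ) : Prop := ∀ z ∈ U, wronskian f z = 0

/-- The coefficient of `η ∈ ⋀ⁿ T_p ℙⁿ` in the frame `∂/∂w¹ ∧ ⋯ ∧ ∂/∂wⁿ` of the affine chart
`{ zᵢ ≠ 0 }`. -/
def frameCoeff (i : Fin (n + 1)) (p : ProjSpace n) (η : ⋀[ℂ]^n (Tan p)) : ℂ :=
  exteriorPower.alternatingMapLinearEquiv (Pi.basisFun ℂ (Fin n)).det
    (exteriorPower.map n (components i p).toLinearMap η)

/-- A section `W` along `f` of the dual of the canonical bundle is holomorphic on `U`: so is its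
coefficient in the holomorphic frame `∂/∂w¹ ∧ ⋯ ∧ ∂/∂wⁿ` of each affine chart, where this frame
is defined. -/
def IsHolomorphicAlong (f : ℂ → ProjSpace n) (U : Set ℂ)
    (W : (z : ℂ) → ⋀[ℂ]^n (Tan (f z))) : Prop :=
  ∀ i : Fin (n + 1), DifferentiableOn ℂ (fun z => frameCoeff i (f z) (W z))
    (U ∩ f ⁻¹' affineSet i)

end FubiniStudy

end

namespace FubiniStudy

section Wirtinger

variable {E F : Type*} [NormedAddCommGroup E] [NormedSpace ℂ E]
  [NormedAddCommGroup F] [NormedSpace ℂ F] {x v : E}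

theorem dHol_congr {h k : E → F} (hk : h =ᶠ[nhds x] k) : dHol h x v = dHol k x v := by
  simp only [dHol, hk.fderiv_eq]

theorem dHol_const (c : F) : dHol (fun _ : E => c) x v = 0 := by
  simp [dHol]

theorem dHol_add {h k : E → F} (hh : DifferentiableAt ℝ h x) (hk : DifferentiableAt ℝ k x) :
    dHol (fun y => h y + k y) x v = dHol h x v + dHol k x v := by
  simp only [dHol, fderiv_fun_add hh hk, add_apply, smul_add, smul_sub]
  abel

theorem dHol_sub {h k : E → F} (hh : DifferentiableAt ℝ h x) (hk : DifferentiableAt ℝ k x) :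
    dHol (fun y => h y - k y) x v = dHol h x v - dHol k x v := by
  simp only [dHol, fderiv_fun_sub hh hk, sub_apply, smul_sub]
  abel

theorem dHol_sum {ι : Type*} (s : Finset ι) {h : ι → E → F}
    (hh : ∀ i ∈ s, DifferentiableAt ℝ (h i) x) :
    dHol (fun y => ∑ i ∈ s, h i y) x v = ∑ i ∈ s, dHol (h i) x v := by
  simp only [dHol, fderiv_fun_sum hh, sum_apply, Finset.smul_sum,
    Finset.sum_sub_distrib, smul_sub]

theorem dHol_mul {h k : E → ℂ} (hh : DifferentiableAt ℝ h x) (hk : DifferentiableAt ℝ k x) :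
    dHol (fun y => h y * k y) x v = h x * dHol k x v + k x * dHol h x v := by
  simp only [dHol, fderiv_fun_mul hh hk, add_apply, smul_apply, smul_eq_mul]
  ring

theorem dHol_inv {h : E → ℂ} (hh : DifferentiableAt ℝ h x) (h0 : h x ≠ 0) :
    dHol (fun y => (h y)⁻¹) x v = -dHol h x v / h x ^ 2 := by
  have := (hasDerivAt_inv h0).hasFDerivAt.restrictScalars ℝ |>.comp x hh.hasFDerivAt
  have h2 : fderiv ℝ (fun y => (h y)⁻¹) x = _ := this.fderiv
  simp only [dHol, h2]
  simp
  field_simp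
  ring

theorem dHol_of_differentiableAt {h : E → F} (hh : DifferentiableAt ℂ h x) :
    dHol h x v = fderiv ℂ h x v := by
  have h2 : fderiv ℝ h x = _ := (hh.hasFDerivAt.restrictScalars ℝ).fderiv
  simp only [dHol, h2]
  simp only [ContinuousLinearMap.coe_restrictScalars', map_smul, smul_smul, Complex.I_mul_I,
    neg_smul, one_smul, sub_neg_eq_add]
  rw [← two_smul ℂ, smul_smul]
  norm_num

theorem dHol_eq_deriv {h : ℂ → F} {z : ℂ} (hh : DifferentiableAt ℂ h z) :
    dHol h z 1 = deriv h z := by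
  rw [dHol_of_differentiableAt hh, fderiv_apply_one_eq_deriv]

theorem dHol_conj {h : E → ℂ} (hh : DifferentiableAt ℂ h x) :
    dHol (fun y => starRingEnd ℂ (h y)) x v = 0 := by
  have h1 := hh.hasFDerivAt.restrictScalars ℝ
  have h2 : fderiv ℝ (fun y => starRingEnd ℂ (h y)) x = _ :=
    (Complex.conjCLE.toContinuousLinearMap.hasFDerivAt.comp x h1).fderiv
  simp only [dHol, h2]
  simp only [ContinuousLinearMap.comp_apply, ContinuousLinearMap.coe_restrictScalars', map_smul,
    smul_eq_mul, ContinuousLinearEquiv.coe_coe, Complex.conjCLE_apply, map_mul, Complex.conj_I]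
  linear_combination (1 / 2 : ℂ) * (starRingEnd ℂ) ((fderiv ℂ h x) v) * Complex.I_mul_I

theorem dHol_apply {ι : Type*} [Fintype ι] {h : E → ι → ℂ} (hh : DifferentiableAt ℝ h x) (k : ι) :
    dHol (fun y => h y k) x v = dHol h x v k := by
  have h2 : fderiv ℝ (fun y => h y k) x = _ :=
    ((ContinuousLinearMap.proj (R := ℝ) (φ := fun _ : ι => ℂ) k).hasFDerivAt.comp x
      hh.hasFDerivAt).fderiv
  simp [dHol, h2]

theorem contDiffOn_dHol {h : ℂ → F} {O : Set ℂ} (hO : IsOpen O) (hh : ContDiffOn ℝ ∞ h O) :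
    ContDiffOn ℝ ∞ (fun z => dHol h z 1) O := by
  have h1 : ContDiffOn ℝ ∞ (fderiv ℝ h) O := hh.fderiv_of_isOpen hO (by simp)
  unfold dHol
  have h2 : ∀ v : ℂ, ContDiffOn ℝ ∞ (fun z => fderiv ℝ h z v) O :=
    fun v => h1.clm_apply contDiffOn_const
  exact ((h2 1).sub ((h2 _).const_smul Complex.I)).const_smul (1 / 2 : ℂ)

end Wirtinger

variable {n : ℕ}

/-- The Hermitian square norm `1 + ∑ wₖ w̄ₖ` of the affine lift. -/
def affineNormSq (w : Fin n → ℂ) : ℂ := 1 + ∑ k, w k * starRingEnd ℂ (w k)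

theorem affineNormSq_eq_ofReal (w : Fin n → ℂ) :
    affineNormSq w = ((1 + ∑ k, Complex.normSq (w k) : ℝ) : ℂ) := by
  simp [affineNormSq, Complex.mul_conj]

theorem one_add_sum_normSq_pos (w : Fin n → ℂ) : 0 < 1 + ∑ k, Complex.normSq (w k) := by
  have : 0 ≤ ∑ k, Complex.normSq (w k) := Finset.sum_nonneg fun k _ => Complex.normSq_nonneg _
  linarith

theorem affineNormSq_ne_zero (w : Fin n → ℂ) : affineNormSq w ≠ 0 := by
  rw [affineNormSq_eq_ofReal]
  exact_mod_cast (one_add_sum_normSq_pos w).ne'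

theorem contDiff_conj : ContDiff ℝ ∞ (starRingEnd ℂ) :=
  Complex.conjCLE.toContinuousLinearMap.contDiff

theorem contDiff_affineNormSq : ContDiff ℝ ∞ (affineNormSq (n := n)) := by
  unfold affineNormSq
  refine contDiff_const.add (ContDiff.sum fun k _ => ?_)
  exact (contDiff_apply ℝ ℂ k).mul (contDiff_conj.comp (contDiff_apply ℝ ℂ k))

theorem differentiableAt_affineNormSq (w : Fin n → ℂ) : DifferentiableAt ℝ affineNormSq w :=
  (contDiff_affineNormSq.differentiable (by simp)).differentiableAt

theorem differentiableAt_coord (k : Fin n) (w : Fin n → ℂ) :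
    DifferentiableAt ℝ (fun u : Fin n → ℂ => u k) w :=
  differentiableAt_apply k w

theorem differentiableAt_conj_coord (k : Fin n) (w : Fin n → ℂ) :
    DifferentiableAt ℝ (fun u : Fin n → ℂ => starRingEnd ℂ (u k)) w :=
  ((contDiff_conj.comp (contDiff_apply ℝ ℂ k)).differentiable (by simp)).differentiableAt

theorem dHol_coord (k : Fin n) (w v : Fin n → ℂ) :
    dHol (fun u : Fin n → ℂ => u k) w v = v k := by
  rw [dHol_of_differentiableAt (differentiableAt_apply k w)]
  have : fderiv ℂ (fun u : Fin n → ℂ => u k) w = _ :=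
    (ContinuousLinearMap.proj (R := ℂ) (φ := fun _ : Fin n => ℂ) k).fderiv
  simp [this]

theorem dHol_conj_coord (k : Fin n) (w v : Fin n → ℂ) :
    dHol (fun u : Fin n → ℂ => starRingEnd ℂ (u k)) w v = 0 :=
  dHol_conj (differentiableAt_apply k w)

theorem dHol_affineNormSq (w : Fin n → ℂ) (j : Fin n) :
    dHol affineNormSq w (Pi.single j 1) = starRingEnd ℂ (w j) := by
  have h1 : ∀ k ∈ Finset.univ, DifferentiableAt ℝ
      (fun u : Fin n → ℂ => u k * starRingEnd ℂ (u k)) w := fun k _ =>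
    (differentiableAt_coord k w).mul (differentiableAt_conj_coord k w)
  unfold affineNormSq
  rw [dHol_add (differentiableAt_const _) (DifferentiableAt.fun_sum h1), dHol_const,
    dHol_sum _ h1, zero_add]
  simp only [dHol_mul (differentiableAt_coord _ w) (differentiableAt_conj_coord _ w),
    dHol_coord, dHol_conj_coord]
  simp [Pi.single_apply]

theorem dAnti_potential (w : Fin n → ℂ) (l : Fin n) :
    dAnti potential w (Pi.single l 1) = w l * (affineNormSq w)⁻¹ := by
  have h1 : HasFDerivAt (fun u : Fin n → ℂ => 1 + ∑ k, Complex.normSq (u k))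
      (∑ k, (2 • innerSL ℝ (w k)).comp (ContinuousLinearMap.proj (R := ℝ)
        (φ := fun _ : Fin n => ℂ) k)) w := by
    refine HasFDerivAt.const_add _ (HasFDerivAt.fun_sum fun k _ => ?_)
    have := (hasStrictFDerivAt_norm_sq (w k)).hasFDerivAt.comp w
      (ContinuousLinearMap.proj (R := ℝ) (φ := fun _ : Fin n => ℂ) k).hasFDerivAt
    simpa only [Function.comp_def, ← Complex.normSq_eq_norm_sq, ContinuousLinearMap.proj_apply]
      using this
  have h2 : fderiv ℝ potential w = _ := (Complex.ofRealCLM.hasFDerivAt.comp w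
    (h1.log (one_add_sum_normSq_pos w).ne')).fderiv
  have h3 : ∀ c : ℂ, (fderiv ℝ potential w) (Pi.single l c) =
      (w l * starRingEnd ℂ c + starRingEnd ℂ (w l) * c) * (affineNormSq w)⁻¹ := by
    intro c
    have h4 : ∑ k, inner ℝ (w k) ((Pi.single l c : Fin n → ℂ) k) = inner ℝ (w l) c := by
      rw [Finset.sum_eq_single l]
      · simp
      · intro k _ hk
        simp [Pi.single_eq_of_ne hk]
      · simp
    rw [h2, affineNormSq_eq_ofReal]
    simp only [ContinuousLinearMap.comp_apply, smul_apply, sum_apply,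
      Complex.ofRealCLM_apply, ContinuousLinearMap.proj_apply, innerSL_apply_apply,
      ← Finset.smul_sum, h4]
    rw [Complex.inner]
    push_cast [smul_eq_mul, nsmul_eq_mul]
    rw [mul_comm]
    congr 1
    apply Complex.ext <;> simp <;> ring
  have h5 : Complex.I • (Pi.single l (1 : ℂ) : Fin n → ℂ) = Pi.single l Complex.I := by
    rw [← Pi.single_smul, smul_eq_mul, mul_one]
  rw [dAnti, h5, h3, h3]
  simp only [map_one, Complex.conj_I, smul_eq_mul]
  linear_combination (-(1/2 : ℂ)) * (w l - starRingEnd ℂ (w l)) * (affineNormSq w)⁻¹ *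
    Complex.I_mul_I

theorem metric_apply (w : Fin n → ℂ) (j l : Fin n) :
    metric w j l = (Pi.single j 1 : Fin n → ℂ) l * (affineNormSq w)⁻¹ -
      w l * starRingEnd ℂ (w j) * ((affineNormSq w)⁻¹ * (affineNormSq w)⁻¹) := by
  have hs := affineNormSq_ne_zero w
  simp only [metric, Matrix.of_apply, dAnti_potential]
  have h1 : DifferentiableAt ℝ (fun u : Fin n → ℂ => (affineNormSq u)⁻¹) w :=
    (differentiableAt_affineNormSq w).inv hs
  rw [dHol_mul (differentiableAt_coord l w) h1,
    dHol_inv (differentiableAt_affineNormSq w) hs, dHol_affineNormSq, dHol_coord]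
  field_simp
  ring

theorem dHol_metric (w : Fin n → ℂ) (i j l : Fin n) :
    dHol (fun u => metric u j l) w (Pi.single i 1) =
      -(starRingEnd ℂ (w i) * metric w j l + starRingEnd ℂ (w j) * metric w i l) /
        affineNormSq w := by
  have hs := affineNormSq_ne_zero w
  have h1 : DifferentiableAt ℝ (fun u : Fin n → ℂ => (affineNormSq u)⁻¹) w :=
    (differentiableAt_affineNormSq w).inv hs
  have h2 : DifferentiableAt ℝ (fun u : Fin n → ℂ => u l * starRingEnd ℂ (u j)) w :=
    (differentiableAt_coord l w).mul (differentiableAt_conj_coord j w)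
  have h3 : dHol (fun y => (affineNormSq y)⁻¹) w (Pi.single i 1) = _ :=
    dHol_inv (differentiableAt_affineNormSq w) hs
  simp only [metric_apply]
  rw [dHol_sub ((differentiableAt_const _).fun_mul h1) (h2.fun_mul (h1.fun_mul h1)),
    dHol_mul (differentiableAt_const _) h1, dHol_mul h2 (h1.fun_mul h1), dHol_mul h1 h1,
    dHol_mul (differentiableAt_coord l w) (differentiableAt_conj_coord j w), h3,
    dHol_affineNormSq, dHol_coord, dHol_conj_coord, dHol_const]
  field_simp
  ring

theorem metric_mul_inv (w : Fin n → ℂ) : metric w * (metric w)⁻¹ = 1 := by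
  have hs := affineNormSq_ne_zero w
  have h : metric w * Matrix.of (fun l k => affineNormSq w *
      ((Pi.single l 1 : Fin n → ℂ) k + starRingEnd ℂ (w l) * w k)) = 1 := by
    ext j k
    simp only [Matrix.mul_apply, Matrix.of_apply, metric_apply]
    have e : ∀ l, ((Pi.single j 1 : Fin n → ℂ) l * (affineNormSq w)⁻¹ -
        w l * starRingEnd ℂ (w j) * ((affineNormSq w)⁻¹ * (affineNormSq w)⁻¹)) *
        (affineNormSq w * ((Pi.single l 1 : Fin n → ℂ) k + starRingEnd ℂ (w l) * w k)) =
        (Pi.single j 1 : Fin n → ℂ) l * (Pi.single l 1 : Fin n → ℂ) k +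
        (Pi.single j 1 : Fin n → ℂ) l * (starRingEnd ℂ (w l) * w k) -
        (Pi.single l 1 : Fin n → ℂ) k * (w l * starRingEnd ℂ (w j) * (affineNormSq w)⁻¹) -
        (w l * starRingEnd ℂ (w l)) * (starRingEnd ℂ (w j) * w k * (affineNormSq w)⁻¹) := by
      intro l
      field_simp
      ring
    simp only [e, Finset.sum_sub_distrib, Finset.sum_add_distrib, ← Finset.sum_mul]
    have e2 : ∑ l, w l * starRingEnd ℂ (w l) = affineNormSq w - 1 := by simp [affineNormSq]
    have e3 : ∀ (c : Fin n → ℂ) (k : Fin n), ∑ l, (Pi.single l 1 : Fin n → ℂ) k * c l = c k := by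
      intro c k
      simp [Pi.single_apply]
    have e4 : ∀ (c : Fin n → ℂ) (k : Fin n), ∑ l, (Pi.single k 1 : Fin n → ℂ) l * c l = c k := by
      intro c k
      simp [Pi.single_apply]
    rw [e2, e3, e4, e4, Matrix.one_apply, Pi.single_apply]
    simp only [eq_comm (a := k)]
    field_simp
    ring
  rw [Matrix.inv_eq_right_inv h, h]

/-- The Christoffel symbols of the Fubini–Study metric in affine coordinates. -/
theorem christoffel_eq (w : Fin n → ℂ) (k i j : Fin n) :
    christoffel w k i j =
      -(starRingEnd ℂ (w i) * (Pi.single j 1 : Fin n → ℂ) k +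
        starRingEnd ℂ (w j) * (Pi.single i 1 : Fin n → ℂ) k) / affineNormSq w := by
  have h : ∀ j k, ∑ l, metric w j l * (metric w)⁻¹ l k = (Pi.single j 1 : Fin n → ℂ) k := by
    intro j k
    rw [← Matrix.mul_apply, metric_mul_inv, Matrix.one_apply, Pi.single_apply]
    simp only [eq_comm]
  rw [← h, ← h, christoffel]
  simp only [dHol_metric, Finset.mul_sum, ← Finset.sum_add_distrib, ← Finset.sum_neg_distrib,
    Finset.sum_div]
  refine Finset.sum_congr rfl fun l _ => ?_
  ring

theorem sum_christoffel (w X Y : Fin n → ℂ) (k : Fin n) :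
    ∑ a, ∑ b, christoffel w k a b * X a * Y b =
      -((∑ a, X a * starRingEnd ℂ (w a)) * Y k + (∑ a, Y a * starRingEnd ℂ (w a)) * X k) /
        affineNormSq w := by
  have e : ∀ a b, christoffel w k a b * X a * Y b =
      -((X a * starRingEnd ℂ (w a)) * ((Pi.single b 1 : Fin n → ℂ) k * Y b) +
        ((Pi.single a 1 : Fin n → ℂ) k * X a) * (Y b * starRingEnd ℂ (w b))) /
          affineNormSq w := by
    intro a b
    rw [christoffel_eq]
    ring
  simp only [e, ← Finset.sum_div, Finset.sum_neg_distrib, Finset.sum_add_distrib,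
    ← Finset.mul_sum, ← Finset.sum_mul]
  simp only [Pi.single_apply, ite_mul, one_mul, zero_mul, Finset.sum_ite_eq, Finset.mem_univ,
    if_true]
  ring

/-- The differential of `affineLift i`: insert `0` at place `i`. -/
noncomputable def affineVec (i : Fin (n + 1)) : (Fin n → ℂ) →L[ℂ] (Fin (n + 1) → ℂ) :=
  ContinuousLinearMap.pi (i.insertNth (α := fun _ => (Fin n → ℂ) →L[ℂ] ℂ) 0
    fun k => ContinuousLinearMap.proj k)

theorem affineVec_self (i : Fin (n + 1)) (X : Fin n → ℂ) : affineVec i X i = 0 := by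
  simp [affineVec]

theorem affineVec_succAbove (i : Fin (n + 1)) (X : Fin n → ℂ) (k : Fin n) :
    affineVec i X (i.succAbove k) = X k := by
  simp [affineVec]

/-- The components in the chart `{ zₘ ≠ 0 }` of the tangent vector at `[F]` represented by
`X ∈ ℂⁿ⁺¹`. -/
noncomputable def affineProj (m : Fin (n + 1)) (F X : Fin (n + 1) → ℂ) : Fin n → ℂ :=
  fun k => (X (m.succAbove k) * F m - F (m.succAbove k) * X m) / F m ^ 2

theorem hasFDerivAt_affineLift (i l : Fin (n + 1)) (w : Fin n → ℂ) :
    HasFDerivAt (fun u => affineLift i u l)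
      ((ContinuousLinearMap.proj (R := ℂ) (φ := fun _ => ℂ) l).comp (affineVec i)) w := by
  refine Fin.succAboveCases i ?_ ?_ l
  · simp only [affineLift_self]
    convert hasFDerivAt_const (1 : ℂ) w
    ext X
    simp [affineVec_self]
  · intro k
    simp only [affineLift_succAbove]
    have h : (ContinuousLinearMap.proj (R := ℂ) (φ := fun _ => ℂ) (i.succAbove k)).comp
        (affineVec i) = ContinuousLinearMap.proj (R := ℂ) (φ := fun _ : Fin n => ℂ) k :=
      ContinuousLinearMap.ext fun X => affineVec_succAbove i X k
    rw [h]
    exact (ContinuousLinearMap.proj (R := ℂ) (φ := fun _ : Fin n => ℂ) k).hasFDerivAt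

/-- The coordinates in the chart `{ zₘ ≠ 0 }` of a point given by those in `{ zᵢ ≠ 0 }`. -/
noncomputable def transition (i m : Fin (n + 1)) (w : Fin n → ℂ) : Fin n → ℂ :=
  fun k => affineLift i w (m.succAbove k) / affineLift i w m

theorem hasFDerivAt_transition (i m : Fin (n + 1)) (w : Fin n → ℂ) (h : affineLift i w m ≠ 0) :
    ∃ L : (Fin n → ℂ) →L[ℂ] (Fin n → ℂ), HasFDerivAt (transition i m) L w ∧
      ∀ X, L X = affineProj m (affineLift i w) (affineVec i X) := by
  refine ⟨_, hasFDerivAt_pi.2 fun k =>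
    (hasFDerivAt_affineLift i (m.succAbove k) w).mul
      ((hasDerivAt_inv h).comp_hasFDerivAt w (hasFDerivAt_affineLift i m w)), ?_⟩
  intro X
  funext k
  simp [affineProj]
  field_simp
  ring

theorem affineLift_affineCoord_ne_zero {i m : Fin (n + 1)} {p : ProjSpace n}
    (hi : p ∈ affineSet i) (hm : p ∈ affineSet m) : affineLift i (affineCoord i p) m ≠ 0 := by
  rw [← affinePoint_affineCoord i p hi] at hm
  exact (mk_mem_affineSet m _ (affineLift_ne_zero i _)).1 hm

theorem affineCoord_eq_transition {i : Fin (n + 1)} (m : Fin (n + 1)) {p : ProjSpace n}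
    (hi : p ∈ affineSet i) : affineCoord m p = transition i m (affineCoord i p) := by
  conv_lhs => rw [← affinePoint_affineCoord i p hi]
  exact affineCoord_mk m _ (affineLift_ne_zero i _)

theorem affineChart_mdifferentiable (i : Fin (n + 1)) :
    (affineChart (n := n) i).MDifferentiable 𝓘(ℂ, Fin n → ℂ) 𝓘(ℂ, Fin n → ℂ) :=
  mdifferentiable_of_mem_atlas (I := 𝓘(ℂ, Fin n → ℂ)) (Set.mem_range_self i)

theorem components_bijective {i : Fin (n + 1)} {p : ProjSpace n} (hi : p ∈ affineSet i) :
    Function.Bijective (components i p) :=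
  (affineChart_mdifferentiable i).mfderiv_bijective hi

theorem components_inverse {i : Fin (n + 1)} {p : ProjSpace n} (hi : p ∈ affineSet i)
    (X : Fin n → ℂ) : components i p ((components i p).inverse X) = X := by
  let e : Tan p ≃L[ℂ] (Fin n → ℂ) := (affineChart_mdifferentiable i).mfderiv hi
  have h : components i p = e := rfl
  rw [h, ContinuousLinearMap.inverse_equiv]
  exact e.apply_symm_apply X

theorem components_eq_affineProj {i m : Fin (n + 1)} {p : ProjSpace n}
    (hi : p ∈ affineSet i) (hm : p ∈ affineSet m) (X : Tan p) :
    components m p X =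
      affineProj m (affineLift i (affineCoord i p)) (affineVec i (components i p X)) := by
  obtain ⟨L, hL, hLX⟩ := hasFDerivAt_transition i m (affineCoord i p)
    (affineLift_affineCoord_ne_zero hi hm)
  have h1 := ((affineChart_mdifferentiable i).mdifferentiableAt hi).hasMFDerivAt
  have h2 : HasMFDerivAt 𝓘(ℂ, Fin n → ℂ) 𝓘(ℂ, Fin n → ℂ) (transition i m)
    (affineChart i p) L := hL.hasMFDerivAt
  have h3 := (h2.comp p h1).congr_of_eventuallyEq (f₁ := affineChart m) (by
    filter_upwards [(isOpen_affineSet i).mem_nhds hi] with q hq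
    exact affineCoord_eq_transition m hq)
  rw [← hLX, components, h3.mfderiv]
  rfl

theorem components_velocity {i : Fin (n + 1)} {f : ℂ → ProjSpace n} {z : ℂ}
    (hi : f z ∈ affineSet i)
    (hf : MDifferentiableAt 𝓘(ℂ, ℂ) 𝓘(ℂ, Fin n → ℂ) f z) :
    DifferentiableAt ℂ (fun ζ => affineCoord i (f ζ)) z ∧
    components i (f z) (velocity f z) = deriv (fun ζ => affineCoord i (f ζ)) z := by
  have h1 := ((affineChart_mdifferentiable i).mdifferentiableAt hi).hasMFDerivAt
  have h2 : HasMFDerivAt 𝓘(ℂ, ℂ) 𝓘(ℂ, Fin n → ℂ) (fun ζ => affineCoord i (f ζ)) z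
    ((components i (f z)).comp (mfderiv 𝓘(ℂ, ℂ) 𝓘(ℂ, Fin n → ℂ) f z)) :=
    h1.comp z hf.hasMFDerivAt
  let L : ℂ →L[ℂ] (Fin n → ℂ) := (components i (f z)).comp (mfderiv 𝓘(ℂ, ℂ) 𝓘(ℂ, Fin n → ℂ) f z)
  have h3 : HasFDerivAt (fun ζ => affineCoord i (f ζ)) L z := hasMFDerivAt_iff_hasFDerivAt.1 h2
  refine ⟨h3.differentiableAt, ?_⟩
  rw [← fderiv_apply_one_eq_deriv, h3.fderiv]
  rfl

theorem differentiableOn_iteratedDeriv {E : Type*} [NormedAddCommGroup E] [NormedSpace ℂ E]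
    [CompleteSpace E] {g : ℂ → E} {B : Set ℂ} (hB : IsOpen B)
    (hg : DifferentiableOn ℂ g B) (j : ℕ) : DifferentiableOn ℂ (iteratedDeriv j g) B := by
  induction j with
  | zero => simpa [iteratedDeriv_zero] using hg
  | succ j ih =>
    rw [iteratedDeriv_succ]
    exact ih.deriv hB

theorem differentiableOn_det {m : ℕ} {M : ℂ → Matrix (Fin m) (Fin m) ℂ} {B : Set ℂ}
    (hM : ∀ i j, DifferentiableOn ℂ (fun z => M z i j) B) :
    DifferentiableOn ℂ (fun z => (M z).det) B := by
  simp only [Matrix.det_apply]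
  refine DifferentiableOn.fun_sum fun σ _ => ?_
  refine DifferentiableOn.const_smul ?_ _
  exact DifferentiableOn.fun_finsetProd fun i _ => hM _ _

/-- The Wronskian matrix `(gₖ⁽ʲ⁾)` of functions `g₀, g₁, …`. -/
noncomputable def wronskianMatrix {m : ℕ} (g : Fin m → ℂ → ℂ) (z : ℂ) :
    Matrix (Fin m) (Fin m) ℂ :=
  Matrix.of fun j k => iteratedDeriv j (g k) z

theorem differentiableOn_wronskianMatrix {m : ℕ} {g : Fin m → ℂ → ℂ} {B : Set ℂ}
    (hB : IsOpen B) (hg : ∀ k, DifferentiableOn ℂ (g k) B) (j k : Fin m) :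
    DifferentiableOn ℂ (fun z => wronskianMatrix g z j k) B :=
  differentiableOn_iteratedDeriv hB (hg k) j

/-- If the Wronskian of `g₀, …, gₘ` vanishes on a ball where that of `g₀, …, gₘ₋₁` has no zeros,
then `gₘ` is a linear combination of the others with constant coefficients. -/
theorem exists_eq_sum_of_wronskian {m : ℕ} (g : Fin (m + 1) → ℂ → ℂ) {B : Set ℂ}
    (hB : IsOpen B) (hBc : IsPreconnected B) (z₁ : ℂ) (hz₁ : z₁ ∈ B)
    (hg : ∀ k, DifferentiableOn ℂ (g k) B)
    (h0 : ∀ z ∈ B, (wronskianMatrix g z).det = 0)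
    (h1 : ∀ z ∈ B, (wronskianMatrix (fun k : Fin m => g k.castSucc) z).det ≠ 0) :
    ∃ a : Fin m → ℂ, ∀ z ∈ B, ∑ k, a k * g k.castSucc z = g (Fin.last m) z := by
  set N := wronskianMatrix (fun k : Fin m => g k.castSucc) with hN
  set b : ℂ → Fin m → ℂ := fun z j => iteratedDeriv j (g (Fin.last m)) z with hb
  set c : ℂ → Fin m → ℂ := fun z => (N z).det⁻¹ • (N z).cramer (b z) with hc
  have hNc : ∀ z ∈ B, (N z).mulVec (c z) = b z := by
    intro z hz
    rw [hc, Matrix.mulVec_smul, Matrix.mulVec_cramer, smul_smul, inv_mul_cancel₀ (h1 z hz),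
      one_smul]
  have hNd : ∀ j k, DifferentiableOn ℂ (fun z => N z j k) B :=
    differentiableOn_wronskianMatrix hB fun k => hg _
  have hcd : ∀ k, DifferentiableOn ℂ (fun z => c z k) B := by
    intro k
    simp only [hc, Pi.smul_apply, Matrix.cramer_apply, smul_eq_mul]
    refine ((differentiableOn_det hNd).inv h1).mul (differentiableOn_det fun i j => ?_)
    by_cases hjk : j = k
    · subst hjk
      simpa [hb] using differentiableOn_iteratedDeriv hB (hg (Fin.last m)) i
    · simpa [Matrix.updateCol_ne hjk] using hNd i j
  have hrow : ∀ z ∈ B, ∀ j : ℕ, j ≤ m →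
      ∑ k, iteratedDeriv j (g k.castSucc) z * c z k = iteratedDeriv j (g (Fin.last m)) z := by
    intro z hz
    obtain ⟨v, hv0, hv⟩ := Matrix.exists_mulVec_eq_zero_iff.2 (h0 z hz)
    have hv' : ∀ j : ℕ, j ≤ m → ∑ k : Fin m, iteratedDeriv j (g k.castSucc) z * v k.castSucc +
        iteratedDeriv j (g (Fin.last m)) z * v (Fin.last m) = 0 := by
      intro j hj
      have := congrFun hv ⟨j, Nat.lt_succ_of_le hj⟩
      simpa [Matrix.mulVec, dotProduct, wronskianMatrix, Fin.sum_univ_castSucc] using this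
    have hinj : Function.Injective (N z).mulVec :=
      Matrix.mulVec_injective_iff_isUnit.2
        ((Matrix.isUnit_iff_isUnit_det _).2 (isUnit_iff_ne_zero.2 (h1 z hz)))
    have hvl : (fun k : Fin m => v k.castSucc) = -v (Fin.last m) • c z := by
      apply hinj
      rw [Matrix.mulVec_smul, hNc z hz]
      funext j
      have := hv' j j.2.le
      simp only [Matrix.mulVec, dotProduct, hN, wronskianMatrix, Matrix.of_apply, hb,
        Pi.smul_apply, smul_eq_mul]
      linear_combination this
    have hvn : v (Fin.last m) ≠ 0 := by
      intro h
      apply hv0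
      rw [h] at hvl
      funext k
      refine Fin.lastCases h (fun k => ?_) k
      simpa using congrFun hvl k
    intro j hj
    have h2 := hv' j hj
    have h3 : ∀ k : Fin m, v k.castSucc = -v (Fin.last m) * c z k := fun k => congrFun hvl k
    simp only [h3] at h2
    have h4 : ∑ k : Fin m, iteratedDeriv j (g k.castSucc) z * (-v (Fin.last m) * c z k) =
        -v (Fin.last m) * ∑ k : Fin m, iteratedDeriv j (g k.castSucc) z * c z k := by
      rw [Finset.mul_sum]
      exact Finset.sum_congr rfl fun k _ => by ring
    rw [h4] at h2
    apply mul_left_cancel₀ hvn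
    linear_combination -h2
  have hder : ∀ z ∈ B, ∀ k, deriv (fun ζ => c ζ k) z = 0 := by
    intro z hz
    have hz' := hB.mem_nhds hz
    have hinj : Function.Injective (N z).mulVec :=
      Matrix.mulVec_injective_iff_isUnit.2
        ((Matrix.isUnit_iff_isUnit_det _).2 (isUnit_iff_ne_zero.2 (h1 z hz)))
    suffices h : (fun k => deriv (fun ζ => c ζ k) z) = 0 from fun k => congrFun h k
    apply hinj
    rw [Matrix.mulVec_zero]
    funext j
    have hd : ∀ (k : Fin (m + 1)), HasDerivAt (iteratedDeriv j (g k))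
        (iteratedDeriv (j + 1) (g k) z) z := by
      intro k
      rw [iteratedDeriv_succ]
      exact ((differentiableOn_iteratedDeriv hB (hg k) j).differentiableAt hz').hasDerivAt
    have e1 : HasDerivAt (fun ζ => ∑ k : Fin m, iteratedDeriv j (g k.castSucc) ζ * c ζ k)
        (∑ k : Fin m, (iteratedDeriv (j + 1) (g k.castSucc) z * c z k +
          iteratedDeriv j (g k.castSucc) z * deriv (fun ζ => c ζ k) z)) z :=
      HasDerivAt.fun_sum fun k _ =>
        (hd k.castSucc).mul ((hcd k).differentiableAt hz').hasDerivAt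
    have e2 := (hd (Fin.last m)).congr_of_eventuallyEq (f₁ :=
      fun ζ => ∑ k : Fin m, iteratedDeriv j (g k.castSucc) ζ * c ζ k) (by
        filter_upwards [hz'] with ζ hζ
        exact hrow ζ hζ j j.2.le)
    have e3 := e1.unique e2
    rw [Finset.sum_add_distrib, hrow z hz (j + 1) j.2] at e3
    simpa [Matrix.mulVec, dotProduct, hN, wronskianMatrix] using e3
  refine ⟨c z₁, fun z hz => ?_⟩
  have h2 := hrow z hz 0 (Nat.zero_le m)
  simp only [iteratedDeriv_zero] at h2
  rw [← h2]
  refine Finset.sum_congr rfl fun k _ => ?_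
  have := hB.is_const_of_deriv_eq_zero hBc (hcd k) (fun ζ hζ => hder ζ hζ k) hz₁ hz
  rw [this, mul_comm]

/-- Holomorphic functions whose Wronskian vanishes identically are linearly dependent on some
smaller open set. -/
theorem exists_linear_relation_of_wronskian {m : ℕ} (g : Fin m → ℂ → ℂ) {B : Set ℂ}
    (hB : IsOpen B) (hBn : B.Nonempty) (hg : ∀ k, DifferentiableOn ℂ (g k) B)
    (h0 : ∀ z ∈ B, (wronskianMatrix g z).det = 0) :
    ∃ B' ⊆ B, IsOpen B' ∧ B'.Nonempty ∧
      ∃ a : Fin m → ℂ, a ≠ 0 ∧ ∀ z ∈ B', ∑ k, a k * g k z = 0 := by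
  induction m with
  | zero =>
    obtain ⟨z, hz⟩ := hBn
    simpa using h0 z hz
  | succ m ih =>
    by_cases h1 : ∀ z ∈ B, (wronskianMatrix (fun k : Fin m => g k.castSucc) z).det = 0
    · obtain ⟨B', hB', hB'o, hB'n, a, ha, h⟩ := ih (fun k : Fin m => g k.castSucc)
        (fun k => hg _) h1
      refine ⟨B', hB', hB'o, hB'n, Fin.snoc (α := fun _ => ℂ) a 0, fun h2 => ha ?_,
        fun z hz => ?_⟩
      · funext k
        simpa using congrFun h2 k.castSucc
      · simpa [Fin.sum_univ_castSucc] using h z hz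
    · push Not at h1
      obtain ⟨z₁, hz₁, hne⟩ := h1
      have hcont := (differentiableOn_det (differentiableOn_wronskianMatrix hB
        fun k : Fin m => hg k.castSucc)).continuousOn.continuousAt (hB.mem_nhds hz₁)
      obtain ⟨r, hr, hrB⟩ := Metric.mem_nhds_iff.1
        (Filter.inter_mem (hB.mem_nhds hz₁) (hcont.eventually_ne hne))
      obtain ⟨a, ha⟩ := exists_eq_sum_of_wronskian g Metric.isOpen_ball
        (convex_ball z₁ r).isPreconnected z₁ (Metric.mem_ball_self hr)
        (fun k => (hg k).mono fun z hz => (hrB hz).1) (fun z hz => h0 z (hrB hz).1)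
        (fun z hz => (hrB hz).2)
      refine ⟨Metric.ball z₁ r, fun z hz => (hrB hz).1, Metric.isOpen_ball,
        ⟨z₁, Metric.mem_ball_self hr⟩, Fin.snoc (α := fun _ => ℂ) a (-1), fun h2 => ?_,
        fun z hz => ?_⟩
      · simpa using congrFun h2 (Fin.last m)
      · simp [Fin.sum_univ_castSucc, ha z hz]

/-- The Hermitian form `∑ Xₗ F̄ₗ`. -/
noncomputable def herm {ι : Type*} [Fintype ι] (X F : ι → ℂ) : ℂ :=
  ∑ l, X l * starRingEnd ℂ (F l)

theorem herm_affineVec_affineLift (i : Fin (n + 1)) (X w : Fin n → ℂ) :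
    herm (affineVec i X) (affineLift i w) = herm X w := by
  simp [herm, Fin.sum_univ_succAbove _ i, affineVec_self, affineVec_succAbove,
    affineLift_succAbove]

theorem herm_affineLift_self (i : Fin (n + 1)) (w : Fin n → ℂ) :
    herm (affineLift i w) (affineLift i w) = affineNormSq w := by
  simp [herm, Fin.sum_univ_succAbove _ i, affineLift_self, affineLift_succAbove, affineNormSq]

theorem affineNormSq_div {m : Fin (n + 1)} {F : Fin (n + 1) → ℂ} (hF : F m ≠ 0) :
    affineNormSq (fun k => F (m.succAbove k) / F m) =
      herm F F / (F m * starRingEnd ℂ (F m)) := by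
  have h : starRingEnd ℂ (F m) ≠ 0 := by simpa using hF
  rw [herm, Fin.sum_univ_succAbove _ m, add_div, div_self (mul_ne_zero hF h), Finset.sum_div,
    affineNormSq]
  congr 1
  refine Finset.sum_congr rfl fun k _ => ?_
  rw [map_div₀]
  field_simp

theorem herm_affineProj {m : Fin (n + 1)} {F : Fin (n + 1) → ℂ} (hF : F m ≠ 0)
    (X : Fin (n + 1) → ℂ) :
    herm (affineProj m F X) (fun k => F (m.succAbove k) / F m) =
      (herm X F * F m - herm F F * X m) / (F m ^ 2 * starRingEnd ℂ (F m)) := by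
  have h : starRingEnd ℂ (F m) ≠ 0 := by simpa using hF
  have e : herm X F * F m - herm F F * X m =
      ∑ l, (X l * F m - F l * X m) * starRingEnd ℂ (F l) := by
    simp only [herm, Finset.sum_mul, ← Finset.sum_sub_distrib]
    exact Finset.sum_congr rfl fun l _ => by ring
  rw [e, Fin.sum_univ_succAbove _ m, herm, mul_comm (X m), sub_self, zero_mul, zero_add,
    Finset.sum_div]
  refine Finset.sum_congr rfl fun k _ => ?_
  rw [affineProj, map_div₀]
  field_simp

theorem herm_affineProj_div {m : Fin (n + 1)} {F : Fin (n + 1) → ℂ} (hF : F m ≠ 0)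
    (hS : herm F F ≠ 0) (X : Fin (n + 1) → ℂ) :
    herm (affineProj m F X) (fun k => F (m.succAbove k) / F m) /
      affineNormSq (fun k => F (m.succAbove k) / F m) = herm X F / herm F F - X m / F m := by
  have h : starRingEnd ℂ (F m) ≠ 0 := by simpa using hF
  rw [herm_affineProj hF, affineNormSq_div hF]
  field_simp

theorem dHol_affineProj {m : Fin (n + 1)} {F V : ℂ → Fin (n + 1) → ℂ} {z : ℂ}
    (hFm : F z m ≠ 0) (hF : ∀ l, DifferentiableAt ℂ (fun ζ => F ζ l) z)
    (hV : ∀ l, DifferentiableAt ℝ (fun ζ => V ζ l) z) (k : Fin n) :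
    dHol (fun ζ => affineProj m (F ζ) (V ζ) k) z 1 =
      dHol (fun ζ => V ζ (m.succAbove k)) z 1 / F z m
      - V z (m.succAbove k) * deriv (fun ζ => F ζ m) z / F z m ^ 2
      - deriv (fun ζ => F ζ (m.succAbove k)) z * V z m / F z m ^ 2
      - F z (m.succAbove k) * dHol (fun ζ => V ζ m) z 1 / F z m ^ 2
      + 2 * F z (m.succAbove k) * V z m * deriv (fun ζ => F ζ m) z / F z m ^ 3 := by
  have hFr : ∀ l, DifferentiableAt ℝ (fun ζ => F ζ l) z := fun l => (hF l).restrictScalars ℝ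
  have hFi : DifferentiableAt ℝ (fun ζ => (F ζ m)⁻¹) z := (hFr m).fun_inv hFm
  have e : (fun ζ => affineProj m (F ζ) (V ζ) k) = fun ζ =>
      (V ζ (m.succAbove k) * F ζ m - F ζ (m.succAbove k) * V ζ m) *
        ((F ζ m)⁻¹ * (F ζ m)⁻¹) := by
    funext ζ
    rw [affineProj, div_eq_mul_inv, pow_two, mul_inv]
  rw [e, dHol_mul (((hV _).fun_mul (hFr _)).fun_sub ((hFr _).fun_mul (hV _))) (hFi.fun_mul hFi),
    dHol_sub ((hV _).fun_mul (hFr _)) ((hFr _).fun_mul (hV _)), dHol_mul (hV _) (hFr _),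
    dHol_mul (hFr _) (hV _), dHol_mul hFi hFi, dHol_inv (hFr m) hFm, dHol_eq_deriv (hF _),
    dHol_eq_deriv (hF _)]
  field_simp
  ring

/-- The covariant derivative in affine coordinates `w`, of a field with components `B`, velocity
`w'` and derivative `D` of the components. -/
noncomputable def affineCov (w w' B D : Fin n → ℂ) : Fin n → ℂ :=
  D - (herm w' w / affineNormSq w) • B - (herm B w / affineNormSq w) • w'

theorem covDerivComponents_eq {i : Fin (n + 1)} {f : ℂ → ProjSpace n}
    {V : (z : ℂ) → Tan (f z)} {z : ℂ}
    (hV : DifferentiableAt ℝ (fun ζ => components i (f ζ) (V ζ)) z) :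
    covDerivComponents i f V z = affineCov (affineCoord i (f z))
      (components i (f z) (velocity f z)) (components i (f z) (V z))
      (dHol (fun ζ => components i (f ζ) (V ζ)) z 1) := by
  funext k
  have h : affineChart i (f z) = affineCoord i (f z) := rfl
  rw [covDerivComponents, sum_christoffel, dHol_apply hV, h]
  simp only [affineCov, herm, Pi.sub_apply, Pi.smul_apply, smul_eq_mul]
  ring

theorem differentiableAt_affineVec {i : Fin (n + 1)} {B : ℂ → Fin n → ℂ} {z : ℂ}
    (hB : DifferentiableAt ℝ B z) (l : Fin (n + 1)) :
    DifferentiableAt ℝ (fun ζ => affineVec i (B ζ) l) z := by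
  refine Fin.succAboveCases i ?_ ?_ l
  · simp only [affineVec_self]
    exact differentiableAt_const _
  · intro k
    simp only [affineVec_succAbove]
    exact differentiableAt_pi.1 hB k

theorem dHol_affineVec {i : Fin (n + 1)} {B : ℂ → Fin n → ℂ} {z : ℂ}
    (hB : DifferentiableAt ℝ B z) (l : Fin (n + 1)) :
    dHol (fun ζ => affineVec i (B ζ) l) z 1 = affineVec i (dHol B z 1) l := by
  refine Fin.succAboveCases i ?_ ?_ l
  · simp only [affineVec_self, dHol_const]
  · intro k
    simp only [affineVec_succAbove, dHol_apply hB]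

theorem hasDerivAt_affineLift {i : Fin (n + 1)} {w : ℂ → Fin n → ℂ} {w' : Fin n → ℂ} {z : ℂ}
    (hw : HasDerivAt w w' z) (l : Fin (n + 1)) :
    HasDerivAt (fun ζ => affineLift i (w ζ) l) (affineVec i w' l) z :=
  (hasFDerivAt_affineLift i l (w z)).comp_hasDerivAt z hw

/-- The covariant derivative along a curve is independent of the affine chart. -/
theorem covDerivComponents_eq_affineProj {i m : Fin (n + 1)} {f : ℂ → ProjSpace n}
    {V : (z : ℂ) → Tan (f z)} {O : Set ℂ} (hO : IsOpen O) {z : ℂ} (hz : z ∈ O)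
    (hf : MDifferentiableOn 𝓘(ℂ, ℂ) 𝓘(ℂ, Fin n → ℂ) f O)
    (hi : ∀ ζ ∈ O, f ζ ∈ affineSet i) (hm : f z ∈ affineSet m)
    (hV : DifferentiableAt ℝ (fun ζ => components i (f ζ) (V ζ)) z) :
    covDerivComponents m f V z = affineProj m (affineLift i (affineCoord i (f z)))
      (affineVec i (covDerivComponents i f V z)) := by
  have hfz := hf.mdifferentiableAt (hO.mem_nhds hz)
  obtain ⟨hw, hvel⟩ := components_velocity (hi z hz) hfz
  set F : ℂ → Fin (n + 1) → ℂ := fun ζ => affineLift i (affineCoord i (f ζ)) with hFdef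
  have hFd : ∀ l, HasDerivAt (fun ζ => F ζ l)
      (affineVec i (components i (f z) (velocity f z)) l) z := by
    rw [hvel]
    exact hasDerivAt_affineLift hw.hasDerivAt
  have hFm : F z m ≠ 0 := affineLift_affineCoord_ne_zero (hi z hz) hm
  have hS : herm (F z) (F z) ≠ 0 := by
    rw [hFdef, herm_affineLift_self]
    exact affineNormSq_ne_zero _
  have hev : ∀ᶠ ζ in nhds z, components m (f ζ) (V ζ) =
      affineProj m (F ζ) (affineVec i (components i (f ζ) (V ζ))) := by
    filter_upwards [hO.mem_nhds hz, hfz.continuousAt.preimage_mem_nhds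
      ((isOpen_affineSet m).mem_nhds hm)] with ζ hζ hζm
    exact components_eq_affineProj (hi ζ hζ) hζm _
  have hVl := differentiableAt_affineVec (i := i) hV
  have hpd : ∀ k, DifferentiableAt ℝ
      (fun ζ => affineProj m (F ζ) (affineVec i (components i (f ζ) (V ζ))) k) z := by
    intro k
    have hFr : ∀ l, DifferentiableAt ℝ (fun ζ => F ζ l) z :=
      fun l => (hFd l).differentiableAt.restrictScalars ℝ
    simp only [affineProj, div_eq_mul_inv]
    exact (((hVl _).fun_mul (hFr _)).fun_sub ((hFr _).fun_mul (hVl _))).fun_mul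
      (((hFr m).fun_pow 2).fun_inv (pow_ne_zero 2 hFm))
  have hVm : DifferentiableAt ℝ (fun ζ => components m (f ζ) (V ζ)) z :=
    (differentiableAt_pi.2 hpd).congr_of_eventuallyEq hev
  have hcoord : affineCoord m (f z) = fun k => F z (m.succAbove k) / F z m :=
    affineCoord_eq_transition m (hi z hz)
  funext k
  have hd := dHol_affineProj hFm (fun l => (hFd l).differentiableAt) hVl k
  rw [← dHol_congr (hev.mono fun ζ hζ => congrFun hζ k), dHol_apply hVm] at hd
  simp only [dHol_affineVec hV, (hFd _).deriv] at hd
  rw [covDerivComponents_eq hVm, covDerivComponents_eq hV]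
  rw [affineCov, affineCov]
  simp only [Pi.sub_apply, Pi.smul_apply, smul_eq_mul, map_sub, map_smul]
  rw [hd, components_eq_affineProj (hi z hz) hm (velocity f z),
    components_eq_affineProj (hi z hz) hm (V z), hcoord,
    herm_affineProj_div hFm hS, herm_affineProj_div hFm hS,
    ← herm_affineVec_affineLift i (components i (f z) (velocity f z)),
    ← herm_affineVec_affineLift i (components i (f z) (V z)), ← herm_affineLift_self i]
  have hFz : affineLift i (affineCoord i (f z)) = F z := rfl
  simp only [affineProj, Pi.sub_apply, Pi.smul_apply, smul_eq_mul, hFz]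
  change _ - (herm _ (F z) / herm (F z) (F z) - _) * _ - (herm _ (F z) / herm (F z) (F z) - _) * _
    = _
  generalize herm (affineVec i (components i (f z) (velocity f z))) (F z) / herm (F z) (F z) = φ
  generalize herm (affineVec i (components i (f z) (V z))) (F z) / herm (F z) (F z) = ψ
  change _ = ((_ - φ * _ - ψ * _) * F z m - F z (m.succAbove k) * (_ - φ * _ - ψ * _)) / F z m ^ 2
  field_simp
  ring

/-- The components of the iterated covariant derivatives of the velocity of the curve `w` in
affine coordinates. -/
noncomputable def affineJet (w : ℂ → Fin n → ℂ) : ℕ → ℂ → Fin n → ℂ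
  | 0 => deriv w
  | k + 1 => fun z => affineCov (w z) (deriv w z) (affineJet w k z) (dHol (affineJet w k) z 1)

theorem contDiffOn_herm {O : Set ℂ} {X F : ℂ → Fin n → ℂ} (hX : ContDiffOn ℝ ∞ X O)
    (hF : ContDiffOn ℝ ∞ F O) : ContDiffOn ℝ ∞ (fun z => herm (X z) (F z)) O := by
  unfold herm
  refine ContDiffOn.sum fun l _ => ?_
  exact (contDiffOn_pi.1 hX l).mul (contDiff_conj.comp_contDiffOn (contDiffOn_pi.1 hF l))

theorem contDiffOn_herm_div {O : Set ℂ} {X w : ℂ → Fin n → ℂ} (hX : ContDiffOn ℝ ∞ X O)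
    (hw : ContDiffOn ℝ ∞ w O) :
    ContDiffOn ℝ ∞ (fun z => herm (X z) (w z) / affineNormSq (w z)) O := by
  simp only [div_eq_mul_inv]
  exact (contDiffOn_herm hX hw).mul
    ((contDiff_affineNormSq.comp_contDiffOn hw).inv fun z _ => affineNormSq_ne_zero _)

theorem contDiffOn_of_differentiableOn {E : Type*} [NormedAddCommGroup E] [NormedSpace ℂ E]
    [CompleteSpace E] {O : Set ℂ} (hO : IsOpen O) {w : ℂ → E} (hw : DifferentiableOn ℂ w O) :
    ContDiffOn ℝ ∞ w O :=
  (hw.contDiffOn hO).restrict_scalars ℝ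

theorem contDiffOn_affineJet {O : Set ℂ} (hO : IsOpen O) {w : ℂ → Fin n → ℂ}
    (hw : DifferentiableOn ℂ w O) (k : ℕ) : ContDiffOn ℝ ∞ (affineJet w k) O := by
  have h0 := contDiffOn_of_differentiableOn hO hw
  have h1 := contDiffOn_of_differentiableOn hO (hw.deriv hO)
  induction k with
  | zero => exact h1
  | succ k ih =>
    unfold affineJet affineCov
    exact ((contDiffOn_dHol hO ih).sub ((contDiffOn_herm_div h1 h0).smul ih)).sub
      ((contDiffOn_herm_div ih h0).smul h1)

theorem differentiableAt_of_contDiffOn {E : Type*} [NormedAddCommGroup E] [NormedSpace ℝ E]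
    {O : Set ℂ} (hO : IsOpen O) {h : ℂ → E} (hh : ContDiffOn ℝ ∞ h O) {z : ℂ} (hz : z ∈ O) :
    DifferentiableAt ℝ h z :=
  (hh.differentiableOn (by simp)).differentiableAt (hO.mem_nhds hz)

theorem components_jet {i : Fin (n + 1)} {f : ℂ → ProjSpace n} {O : Set ℂ} (hO : IsOpen O)
    (hf : MDifferentiableOn 𝓘(ℂ, ℂ) 𝓘(ℂ, Fin n → ℂ) f O) (hi : ∀ ζ ∈ O, f ζ ∈ affineSet i)
    (k : ℕ) :
    ∀ z ∈ O, components i (f z) (jet f k z) = affineJet (fun ζ => affineCoord i (f ζ)) k z := by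
  have hv := fun z hz => components_velocity (hi z hz) (hf.mdifferentiableAt (hO.mem_nhds hz))
  have hw : DifferentiableOn ℂ (fun ζ => affineCoord i (f ζ)) O :=
    fun z hz => (hv z hz).1.differentiableWithinAt
  induction k with
  | zero => exact fun z hz => (hv z hz).2
  | succ k ih =>
    intro z hz
    have hev : (fun ζ => components i (f ζ) (jet f k ζ)) =ᶠ[nhds z]
        affineJet (fun ζ => affineCoord i (f ζ)) k := by
      filter_upwards [hO.mem_nhds hz] with ζ hζ
      exact ih ζ hζ
    have hd := (differentiableAt_of_contDiffOn hO (contDiffOn_affineJet hO hw k)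
      hz).congr_of_eventuallyEq hev
    have hm := mem_affineSet_chartIndex (f z)
    obtain ⟨Y, hY⟩ := (components_bijective (hi z hz)).2 (covDerivComponents i f (jet f k) z)
    have h1 : components (chartIndex (f z)) (f z) (jet f (k + 1) z) =
        components (chartIndex (f z)) (f z) Y := by
      rw [components_eq_affineProj (hi z hz) hm Y, hY,
        ← covDerivComponents_eq_affineProj hO hz hf hi hm hd]
      exact components_inverse hm _
    rw [(components_bijective hm).1 h1, hY, covDerivComponents_eq hd, dHol_congr hev,
      (hv z hz).2, ih z hz]
    rfl

theorem exists_affineJet_eq_sum {O : Set ℂ} (hO : IsOpen O) {w : ℂ → Fin n → ℂ}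
    (hw : DifferentiableOn ℂ w O) (k : ℕ) :
    ∃ c : ℕ → ℂ → ℂ, (∀ j, ContDiffOn ℝ ∞ (c j) O) ∧ (∀ z, c k z = 1) ∧
      (∀ j, k < j → c j = fun _ => 0) ∧
      ∀ z ∈ O, affineJet w k z =
        ∑ j ∈ Finset.range (k + 1), c j z • iteratedDeriv (j + 1) w z := by
  induction k with
  | zero =>
    refine ⟨fun j _ => if j = 0 then 1 else 0, fun j => contDiffOn_const, fun z => if_pos rfl,
      fun j hj => funext fun _ => if_neg hj.ne', fun z _ => ?_⟩
    simp [affineJet, iteratedDeriv_one]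
  | succ k ih =>
    obtain ⟨c, hc, hck, hc0, hce⟩ := ih
    have h0 := contDiffOn_of_differentiableOn hO hw
    have h1 := contDiffOn_of_differentiableOn hO (hw.deriv hO)
    set φ : ℂ → ℂ := fun z => herm (deriv w z) (w z) / affineNormSq (w z) with hφ
    set ψ : ℂ → ℂ := fun z => herm (affineJet w k z) (w z) / affineNormSq (w z) with hψ
    have hφc : ContDiffOn ℝ ∞ φ O := contDiffOn_herm_div h1 h0
    have hψc : ContDiffOn ℝ ∞ ψ O := contDiffOn_herm_div (contDiffOn_affineJet hO hw k) h0
    set e : ℕ → ℂ → ℂ := fun j => Nat.casesOn j (fun z => -ψ z) fun j => c j with he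
    refine ⟨fun j z => dHol (c j) z 1 - φ z * c j z + e j z, fun j => ?_, fun z => ?_,
      fun j hj => ?_, fun z hz => ?_⟩
    · refine ((contDiffOn_dHol hO (hc j)).sub (hφc.mul (hc j))).add ?_
      cases j with
      | zero => exact hψc.neg
      | succ j => exact hc j
    · simp [hc0 (k + 1) k.lt_succ_self, dHol_const, he, hck]
    · obtain ⟨j, rfl⟩ : ∃ i, j = i + 1 := ⟨j - 1, by omega⟩
      simp [hc0 (j + 1) (by omega), hc0 j (by omega), dHol_const, he]
    · have hz' := hO.mem_nhds hz
      have hcd : ∀ j, DifferentiableAt ℝ (c j) z := fun j =>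
        differentiableAt_of_contDiffOn hO (hc j) hz
      have hDd : ∀ j, DifferentiableAt ℂ (iteratedDeriv j w) z := fun j =>
        (differentiableOn_iteratedDeriv hO hw j).differentiableAt hz'
      have hev : affineJet w k =ᶠ[nhds z] fun z =>
          ∑ j ∈ Finset.range (k + 1), c j z • iteratedDeriv (j + 1) w z := by
        filter_upwards [hz'] with ζ hζ
        exact hce ζ hζ
      have hsd : ∀ j, DifferentiableAt ℝ (fun z => c j z • iteratedDeriv (j + 1) w z) z :=
        fun j => (hcd j).smul ((hDd (j + 1)).restrictScalars ℝ)
      have hterm : ∀ j, dHol (fun z => c j z • iteratedDeriv (j + 1) w z) z 1 =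
          dHol (c j) z 1 • iteratedDeriv (j + 1) w z + c j z • iteratedDeriv (j + 1 + 1) w z := by
        intro j
        have hDl : ∀ l, DifferentiableAt ℝ (fun z => iteratedDeriv (j + 1) w z l) z :=
          differentiableAt_pi.1 ((hDd (j + 1)).restrictScalars ℝ)
        have hD2 : dHol (iteratedDeriv (j + 1) w) z 1 = iteratedDeriv (j + 1 + 1) w z := by
          rw [dHol_eq_deriv (hDd _), iteratedDeriv_succ (n := j + 1)]
        funext l
        rw [← dHol_apply (hsd j)]
        simp only [Pi.smul_apply, smul_eq_mul, Pi.add_apply]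
        rw [dHol_mul (hcd j) (hDl l), dHol_apply ((hDd (j + 1)).restrictScalars ℝ), hD2]
        ring
      have hsum : affineJet w (k + 1) z = dHol (affineJet w k) z 1 - φ z • affineJet w k z -
        ψ z • deriv w z := rfl
      rw [hsum, dHol_congr hev, dHol_sum _ fun j _ => hsd j, hce z hz]
      simp only [hterm, add_smul, sub_smul, mul_smul, Finset.sum_add_distrib,
        Finset.sum_sub_distrib, ← Finset.smul_sum]
      rw [Finset.sum_range_succ' (fun j => e j z • iteratedDeriv (j + 1) w z),
        Finset.sum_range_succ (fun j => c j z • iteratedDeriv (j + 1) w z) (k + 1),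
        Finset.sum_range_succ (fun j => dHol (c j) z 1 • iteratedDeriv (j + 1) w z) (k + 1)]
      have he0 : e 0 z = -ψ z := rfl
      have heS : ∀ j, e (j + 1) z = c j z := fun _ => rfl
      simp only [hc0 (k + 1) k.lt_succ_self, dHol_const, zero_smul, add_zero, he0, heS, zero_add,
        iteratedDeriv_one, neg_smul]
      abel

theorem iteratedDeriv_apply_of_differentiableOn {O : Set ℂ} (hO : IsOpen O) {w : ℂ → Fin n → ℂ}
    (hw : DifferentiableOn ℂ w O) (j : ℕ) (l : Fin n) :
    ∀ z ∈ O, iteratedDeriv j w z l = iteratedDeriv j (fun ζ => w ζ l) z := by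
  induction j with
  | zero => simp
  | succ j ih =>
    intro z hz
    have h1 := ((differentiableOn_iteratedDeriv hO hw j).differentiableAt
      (hO.mem_nhds hz)).hasDerivAt
    have h2 := (hasDerivAt_pi.1 h1 l).congr_of_eventuallyEq
      (f₁ := iteratedDeriv j fun ζ => w ζ l) (by
        filter_upwards [hO.mem_nhds hz] with ζ hζ
        exact (ih ζ hζ).symm)
    rw [iteratedDeriv_succ, iteratedDeriv_succ, h2.deriv]

/-- In affine coordinates the covariant Wronskian is the classical Wronskian of the derivatives
of the coordinates. -/
theorem det_affineJet {O : Set ℂ} (hO : IsOpen O) {w : ℂ → Fin n → ℂ}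
    (hw : DifferentiableOn ℂ w O) {z : ℂ} (hz : z ∈ O) :
    (Matrix.of fun k : Fin n => affineJet w k z).det =
      (wronskianMatrix (fun l => deriv fun ζ => w ζ l) z).det := by
  choose c hc hck hc0 hce using exists_affineJet_eq_sum hO hw
  have h : (Matrix.of fun k : Fin n => affineJet w k z) =
      (Matrix.of fun k j : Fin n => c k j z) *
        wronskianMatrix (fun l => deriv fun ζ => w ζ l) z := by
    ext k l
    have e : affineJet w k z = ∑ j ∈ Finset.range n, c k j z • iteratedDeriv (j + 1) w z := by
      rw [hce k z hz]
      refine Finset.sum_subset (Finset.range_subset_range.2 k.2) fun j _ hj => ?_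
      rw [hc0 k j (by simpa using hj), zero_smul]
    rw [Matrix.mul_apply, Matrix.of_apply, e,
      ← Fin.sum_univ_eq_sum_range fun j => c k j z • iteratedDeriv (j + 1) w z]
    simp only [Finset.sum_apply, Pi.smul_apply, smul_eq_mul, Matrix.of_apply, wronskianMatrix,
      ← iteratedDeriv_succ', iteratedDeriv_apply_of_differentiableOn hO hw _ l z hz]
  rw [h, Matrix.det_mul, Matrix.det_of_isLowerTriangular, Finset.prod_eq_one, one_mul]
  · intro k _
    exact hck k z
  · intro k j hkj
    exact congrFun (hc0 k j hkj) z

theorem frameCoeff_wronskian_eq_det (i : Fin (n + 1)) (f : ℂ → ProjSpace n) (z : ℂ) :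
    frameCoeff i (f z) (wronskian f z) =
      (Matrix.of fun k : Fin n => components i (f z) (jet f k z)).det := by
  rw [frameCoeff, wronskian, exteriorPower.map_apply_ιMulti,
    exteriorPower.alternatingMapLinearEquiv_apply_ιMulti, Module.Basis.det_apply,
    ← Matrix.det_transpose]
  congr 1

theorem wronskian_eq_zero_iff {i : Fin (n + 1)} {f : ℂ → ProjSpace n} {z : ℂ}
    (hi : f z ∈ affineSet i) :
    wronskian f z = 0 ↔ frameCoeff i (f z) (wronskian f z) = 0 := by
  refine ⟨fun h => by rw [h, frameCoeff, map_zero, map_zero], fun h => ?_⟩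
  rw [frameCoeff_wronskian_eq_det] at h
  refine AlternatingMap.map_linearDependent _ _ fun hli => ?_
  have h2 : LinearIndependent ℂ fun k : Fin n => components i (f z) (jet f k z) :=
    hli.map' (components i (f z)).toLinearMap
      (LinearMap.ker_eq_bot.2 (components_bijective hi).1)
  have h3 := Matrix.linearIndependent_rows_iff_isUnit.1
    (show LinearIndependent ℂ
      (Matrix.of fun k : Fin n => components i (f z) (jet f k z)).row from h2)
  rw [Matrix.isUnit_iff_isUnit_det, h] at h3
  exact not_isUnit_zero h3

/-- The coefficient of the covariant Wronskian is the classical Wronskian of the derivatives of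
the affine coordinates. -/
theorem frameCoeff_wronskian {i : Fin (n + 1)} {f : ℂ → ProjSpace n} {O : Set ℂ}
    (hO : IsOpen O) (hf : MDifferentiableOn 𝓘(ℂ, ℂ) 𝓘(ℂ, Fin n → ℂ) f O)
    (hi : ∀ ζ ∈ O, f ζ ∈ affineSet i) {z : ℂ} (hz : z ∈ O) :
    frameCoeff i (f z) (wronskian f z) =
      (wronskianMatrix (fun l => deriv fun ζ => affineCoord i (f ζ) l) z).det := by
  have hw : DifferentiableOn ℂ (fun ζ => affineCoord i (f ζ)) O := fun ζ hζ =>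
    (components_velocity (hi ζ hζ)
      (hf.mdifferentiableAt (hO.mem_nhds hζ))).1.differentiableWithinAt
  rw [frameCoeff_wronskian_eq_det, ← det_affineJet hO hw hz]
  congr 2
  funext k
  exact components_jet hO hf hi k z hz

theorem isOpen_inter_preimage_affineSet {f : ℂ → ProjSpace n} {U : Set ℂ} (hU : IsOpen U)
    (hf : MDifferentiableOn 𝓘(ℂ, ℂ) 𝓘(ℂ, Fin n → ℂ) f U) (i : Fin (n + 1)) :
    IsOpen (U ∩ f ⁻¹' affineSet i) :=
  hf.continuousOn.isOpen_inter_preimage hU (isOpen_affineSet i)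

theorem differentiableOn_affineCoord {f : ℂ → ProjSpace n} {U : Set ℂ} (hU : IsOpen U)
    (hf : MDifferentiableOn 𝓘(ℂ, ℂ) 𝓘(ℂ, Fin n → ℂ) f U) (i : Fin (n + 1)) :
    DifferentiableOn ℂ (fun ζ => affineCoord i (f ζ)) (U ∩ f ⁻¹' affineSet i) := fun ζ hζ =>
  (components_velocity hζ.2
    (hf.mdifferentiableAt (hU.mem_nhds hζ.1))).1.differentiableWithinAt

theorem isHolomorphicAlong_wronskian {f : ℂ → ProjSpace n} {U : Set ℂ} (hU : IsOpen U)
    (hf : MDifferentiableOn 𝓘(ℂ, ℂ) 𝓘(ℂ, Fin n → ℂ) f U) :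
    IsHolomorphicAlong f U (wronskian f) := by
  intro i
  have hO := isOpen_inter_preimage_affineSet hU hf i
  have hw := differentiableOn_affineCoord hU hf i
  refine DifferentiableOn.congr (differentiableOn_det (differentiableOn_wronskianMatrix hO
    fun l => (differentiableOn_pi.1 hw l).deriv hO)) fun z hz => ?_
  exact frameCoeff_wronskian hO (hf.mono Set.inter_subset_left) (fun _ hζ => hζ.2) hz

theorem submodule_le_ker_iff {i : Fin (n + 1)} {p : ProjSpace n} (hi : p ∈ affineSet i)
    (l : (Fin (n + 1) → ℂ) →ₗ[ℂ] ℂ) :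
    p.submodule ≤ LinearMap.ker l ↔ l (affineLift i (affineCoord i p)) = 0 := by
  conv_lhs => rw [← affinePoint_affineCoord i p hi]
  rw [affinePoint, Projectivization.submodule_mk, Submodule.span_singleton_le_iff_mem,
    LinearMap.mem_ker]

theorem linearMap_affineLift (i : Fin (n + 1)) (l : (Fin (n + 1) → ℂ) →ₗ[ℂ] ℂ) (w : Fin n → ℂ) :
    l (affineLift i w) = l (Pi.single i 1) + ∑ k, l (Pi.single (i.succAbove k) 1) * w k := by
  have h : affineLift i w = ∑ j, affineLift i w j • (Pi.single j 1 : Fin (n + 1) → ℂ) :=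
    pi_eq_sum_univ' _
  rw [h, map_sum, Fin.sum_univ_succAbove _ i]
  simp [affineLift_self, affineLift_succAbove, mul_comm]

theorem linearMap_ext_single {l : (Fin (n + 1) → ℂ) →ₗ[ℂ] ℂ} (i : Fin (n + 1))
    (h0 : l (Pi.single i 1) = 0) (h1 : ∀ k, l (Pi.single (i.succAbove k) 1) = 0) : l = 0 := by
  refine LinearMap.pi_ext' fun j => LinearMap.ext_ring ?_
  refine Fin.succAboveCases i ?_ ?_ j
  · simpa using h0
  · intro k
    simpa using h1 k

theorem wronskian_eq_zero_of_linearMap {f : ℂ → ProjSpace n} {U : Set ℂ} (hU : IsOpen U)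
    (hf : MDifferentiableOn 𝓘(ℂ, ℂ) 𝓘(ℂ, Fin n → ℂ) f U)
    {l : (Fin (n + 1) → ℂ) →ₗ[ℂ] ℂ} (hl : l ≠ 0)
    (h : ∀ z ∈ U, (f z).submodule ≤ LinearMap.ker l) {z : ℂ} (hz : z ∈ U) :
    wronskian f z = 0 := by
  have hi := mem_affineSet_chartIndex (f z)
  generalize chartIndex (f z) = i at hi
  have hO := isOpen_inter_preimage_affineSet hU hf i
  have hw := differentiableOn_affineCoord hU hf i
  have hzO : z ∈ U ∩ f ⁻¹' affineSet i := ⟨hz, hi⟩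
  rw [wronskian_eq_zero_iff hi,
    frameCoeff_wronskian hO (hf.mono Set.inter_subset_left) (fun _ hζ => hζ.2) hzO]
  set a : Fin n → ℂ := fun k => l (Pi.single (i.succAbove k) 1) with ha
  have hrel : ∀ ζ ∈ U ∩ f ⁻¹' affineSet i,
      l (Pi.single i 1) + ∑ k, a k * affineCoord i (f ζ) k = 0 := by
    intro ζ hζ
    rw [← linearMap_affineLift]
    exact (submodule_le_ker_iff hζ.2 l).1 (h ζ hζ.1)
  have hder : ∀ j : ℕ, ∀ ζ ∈ U ∩ f ⁻¹' affineSet i,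
      ∑ k, a k * iteratedDeriv (j + 1) (fun ζ => affineCoord i (f ζ) k) ζ = 0 := by
    have hd : ∀ (j : ℕ) (c : ℂ), ∀ ζ ∈ U ∩ f ⁻¹' affineSet i, (∀ ξ ∈ U ∩ f ⁻¹' affineSet i,
        c + ∑ k, a k * iteratedDeriv j (fun ζ => affineCoord i (f ζ) k) ξ = 0) →
        ∑ k, a k * iteratedDeriv (j + 1) (fun ζ => affineCoord i (f ζ) k) ζ = 0 := by
      intro j c ζ hζ hj
      have e1 : HasDerivAt
          (fun ξ => c + ∑ k, a k * iteratedDeriv j (fun ζ => affineCoord i (f ζ) k) ξ)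
          (∑ k, a k * iteratedDeriv (j + 1) (fun ζ => affineCoord i (f ζ) k) ζ) ζ := by
        refine HasDerivAt.const_add _ (HasDerivAt.fun_sum fun k _ => HasDerivAt.const_mul _ ?_)
        rw [iteratedDeriv_succ]
        exact ((differentiableOn_iteratedDeriv hO (differentiableOn_pi.1 hw k)
          j).differentiableAt (hO.mem_nhds hζ)).hasDerivAt
      refine e1.unique ((hasDerivAt_const ζ (0 : ℂ)).congr_of_eventuallyEq ?_)
      filter_upwards [hO.mem_nhds hζ] with ξ hξ
      exact hj ξ hξ
    intro j
    induction j with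
    | zero =>
      exact fun ζ hζ => hd 0 (l (Pi.single i 1)) ζ hζ (by simpa [iteratedDeriv_zero] using hrel)
    | succ j ih =>
      exact fun ζ hζ => hd (j + 1) 0 ζ hζ (by simpa using ih)
  refine Matrix.exists_mulVec_eq_zero_iff.1 ⟨a, fun ha0 => hl ?_, ?_⟩
  · refine linearMap_ext_single i ?_ fun k => congrFun ha0 k
    simpa [ha0] using hrel z hzO
  · funext j
    have := hder j z hzO
    simpa [Matrix.mulVec, dotProduct, wronskianMatrix, ← iteratedDeriv_succ', mul_comm] using this

/-- A hyperplane that contains the image of some open set contains the image of the whole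
domain. -/
theorem submodule_le_ker_of_eventually {f : ℂ → ProjSpace n} {U : Set ℂ} (hU : IsOpen U)
    (hUc : IsPreconnected U) (hf : MDifferentiableOn 𝓘(ℂ, ℂ) 𝓘(ℂ, Fin n → ℂ) f U)
    (l : (Fin (n + 1) → ℂ) →ₗ[ℂ] ℂ) {z₀ : ℂ} (hz₀ : z₀ ∈ U)
    (h : ∀ᶠ z in nhds z₀, (f z).submodule ≤ LinearMap.ker l) :
    ∀ z ∈ U, (f z).submodule ≤ LinearMap.ker l := by
  set S : Set ℂ := {z | ∀ᶠ ζ in nhds z, (f ζ).submodule ≤ LinearMap.ker l} with hS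
  have hSo : IsOpen S := isOpen_setOfPred_eventually_nhds
  have hsub : U ⊆ S := by
    refine hUc.subset_of_closure_inter_subset hSo ⟨z₀, hz₀, h⟩ ?_
    rintro z ⟨hzS, hzU⟩
    have hi := mem_affineSet_chartIndex (f z)
    generalize chartIndex (f z) = i at hi
    have hO := isOpen_inter_preimage_affineSet hU hf i
    obtain ⟨r, hr, hrO⟩ := Metric.isOpen_iff.1 hO z ⟨hzU, hi⟩
    obtain ⟨z₁, hz₁B, hz₁S⟩ := mem_closure_iff.1 hzS _ Metric.isOpen_ball
      (Metric.mem_ball_self hr)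
    have hw := (differentiableOn_affineCoord hU hf i).mono hrO
    have hg : DifferentiableOn ℂ (fun ζ => l (affineLift i (affineCoord i (f ζ))))
        (Metric.ball z r) := by
      simp only [linearMap_affineLift]
      exact (DifferentiableOn.fun_sum fun k _ =>
        (differentiableOn_pi.1 hw k).const_mul _).const_add _
    have hz := (hg.analyticOnNhd Metric.isOpen_ball).eqOn_zero_of_preconnected_of_eventuallyEq_zero
      (convex_ball z r).isPreconnected hz₁B (by
        filter_upwards [hz₁S, Metric.isOpen_ball.mem_nhds hz₁B] with ζ hζ hζB
        exact (submodule_le_ker_iff (hrO hζB).2 l).1 hζ)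
    filter_upwards [Metric.ball_mem_nhds z hr] with ζ hζ
    exact (submodule_le_ker_iff (hrO hζ).2 l).2 (hz hζ)
  exact fun z hz => (hsub hz).self_of_nhds

theorem exists_linearMap_of_isDegenerate {f : ℂ → ProjSpace n} {U : Set ℂ} (hU : IsOpen U)
    (hUc : IsConnected U) (hf : MDifferentiableOn 𝓘(ℂ, ℂ) 𝓘(ℂ, Fin n → ℂ) f U)
    (h : IsDegenerate f U) :
    ∃ l : (Fin (n + 1) → ℂ) →ₗ[ℂ] ℂ, l ≠ 0 ∧ ∀ z ∈ U, (f z).submodule ≤ LinearMap.ker l := by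
  obtain ⟨z, hz⟩ := hUc.nonempty
  have hi := mem_affineSet_chartIndex (f z)
  generalize chartIndex (f z) = i at hi
  have hO := isOpen_inter_preimage_affineSet hU hf i
  have hw := differentiableOn_affineCoord hU hf i
  obtain ⟨B, hBO, hB, ⟨z₁, hz₁⟩, a, ha, hrel⟩ := exists_linear_relation_of_wronskian
    (fun k => deriv fun ζ => affineCoord i (f ζ) k) hO ⟨z, hz, hi⟩
    (fun k => (differentiableOn_pi.1 hw k).deriv hO) (fun ζ hζ => by
      rw [← frameCoeff_wronskian hO (hf.mono Set.inter_subset_left) (fun _ hζ => hζ.2) hζ]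
      exact (wronskian_eq_zero_iff hζ.2).1 (h ζ hζ.1))
  obtain ⟨r, hr, hrB⟩ := Metric.isOpen_iff.1 hB z₁ hz₁
  set g : ℂ → ℂ := fun ζ => ∑ k, a k * affineCoord i (f ζ) k with hg
  have hgd : ∀ ζ ∈ B, HasDerivAt g 0 ζ := by
    intro ζ hζ
    rw [← hrel ζ hζ]
    exact HasDerivAt.fun_sum fun k _ => HasDerivAt.const_mul _
      ((differentiableOn_pi.1 hw k).differentiableAt (hO.mem_nhds (hBO hζ))).hasDerivAt
  have hconst : ∀ ζ ∈ Metric.ball z₁ r, g ζ = g z₁ := fun ζ hζ =>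
    Metric.isOpen_ball.is_const_of_deriv_eq_zero (convex_ball z₁ r).isPreconnected
      (fun ξ hξ => (hgd ξ (hrB hξ)).differentiableAt.differentiableWithinAt)
      (fun ξ hξ => (hgd ξ (hrB hξ)).deriv) hζ (Metric.mem_ball_self hr)
  let v : Fin (n + 1) → ℂ := i.insertNth (α := fun _ => ℂ) (-g z₁) a
  let l : (Fin (n + 1) → ℂ) →ₗ[ℂ] ℂ := ∑ j, v j • LinearMap.proj j
  have hlv : ∀ j, l (Pi.single j 1) = v j := by
    intro j
    simp [l, LinearMap.sum_apply, Pi.single_apply]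
  refine ⟨l, fun hl0 => ha ?_, submodule_le_ker_of_eventually hU hUc.isPreconnected hf l
    (hBO hz₁).1 ?_⟩
  · funext k
    have := hlv (i.succAbove k)
    rw [hl0] at this
    simpa [v] using this.symm
  · filter_upwards [Metric.ball_mem_nhds z₁ hr] with ζ hζ
    rw [submodule_le_ker_iff (hBO (hrB hζ)).2, linearMap_affineLift]
    simp only [hlv]
    have e := hconst ζ hζ
    simp only [hg] at e
    simp [v, e, hg]

end FubiniStudy

/-- For a holomorphic curve `f : U → ℙⁿ` on a domain `U ⊆ ℂ`, the Wronskian for the Fubini–Study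
connection vanishes identically iff `f(U)` lies in a hyperplane, and it is holomorphic. -/
theorem theorem4p1 (n : ℕ) (U : Set ℂ) (hUo : IsOpen U) (hUc : IsConnected U)
    (f : ℂ → FubiniStudy.ProjSpace n)
    (hf : MDifferentiableOn (modelWithCornersSelf ℂ ℂ)
      (modelWithCornersSelf ℂ (Fin n → ℂ)) f U) :
    (FubiniStudy.IsDegenerate f U ↔
      ∃ H : Set (FubiniStudy.ProjSpace n), FubiniStudy.IsHyperplane H ∧ f '' U ⊆ H) ∧
    FubiniStudy.IsHolomorphicAlong f U (FubiniStudy.wronskian f) := by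
  refine ⟨⟨fun h => ?_, ?_⟩, FubiniStudy.isHolomorphicAlong_wronskian hUo hf⟩
  · obtain ⟨l, hl, hlU⟩ := FubiniStudy.exists_linearMap_of_isDegenerate hUo hUc hf h
    exact ⟨_, ⟨l, hl, rfl⟩, Set.image_subset_iff.2 hlU⟩
  · rintro ⟨_, ⟨l, hl, rfl⟩, hH⟩ z hz
    exact FubiniStudy.wronskian_eq_zero_of_linearMap hUo hf hl (Set.image_subset_iff.1 hH) hz
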